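/- Let $\mathbf t = t_0t_1t_2\cdots = 01101001\cdots$ be the Thue–Morse word, i.e. the fixed point, starting with $0$, of the morphism $0\mapsto 01$, $1\mapsto 10$. A nonempty finite word $x$ has period $p$ ($1\le p\le |x|$) if $x[i]=x[i+p]$ for all $0\le i<|x|-p$; its exponent is $\exp(x)=|x|/p(x)$, where $p(x)$ is its smallest period. The circular critical exponent $\operatorname{ccexp}(w)$ of a nonempty finite word $w$ is the supremum of $\exp(x)$ over all nonempty factors (contiguous blocks) $x$ of all conjugates (cyclic shifts) of $w$. (a) For every $n\ge 1$, the prefix $t_0t_1\cdots t_{n-1}$ of length $n$ of $\mathbf t$ satisfies $$\operatorname{ccexp}(t_0\cdots t_{n-1})\in S:=\left\{1,\,2,\,\tfrac73,\,\tfrac52,\,\tfrac{13}5,\,\tfrac83,\,3\right\}.$$ (b) For every $n\ge 1$, $\operatorname{ccexp}(t_0\cdots t_{n-1})$ equals the output $\tau(q)$ of the following automaton with states $0,1,\dots,28$ and initial state $0$, where $q$ is the state reached after reading the base-$2$ representation of $n$ from the most significant digit to the least significant one. So, for each $r\in S$, the prefixes with circular critical exponent $r$ are exactly those whose length $n\geq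 1$ leads to a state with output $r$. $$\begin{array}{c|cccccccccccccccc} q & 0&1&2&3&4&5&6&7&8&9&10&11&12&13&14\\ \hline \delta(q,0) & 0&2&4&6&8&10&11&13&4&16&5&18&19&20&21\\ \delta(q,1) & 1&3&5&7&9&7&12&14&15&7&17&7&9&5&7\\ \tau(q) & -&1&1&2&2&\frac52&2&3&2&\frac83&\frac52&2&\frac73&3&3 \end{array}$$ $$\begin{array}{c|cccccccccccccc} q & 15&16&17&18&19&20&21&22&23&24&25&26&27&28\\ \hline \delta(q,0) & 22&23&24&11&12&25&26&15&27&17&20&28&23&26\\ \delta(q,1) & 7&12&9&17&15&9&12&17&7&15&15&7&17&17\\ \tau(q) & \frac{13}5&\frac83&\frac83&2&\frac73&3&3&\frac{13}5&\frac83&\frac83&3&3&\frac83&3 \end{array}$$ -/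

import Mathlib

/-! ### Periods, exponents and the circular critical exponent of finite words -/

namespace CircWord

variable {α : Type*}

/-- The smallest period `p(w) ≥ 1` of a finite word `w`. A nonempty word always has its own length
as a period, so for nonempty `w` the minimum is attained and `1 ≤ p(w) ≤ |w|`. -/
noncomputable def leastPeriod (w : List α) : ℕ :=
  sInf {p : ℕ | 1 ≤ p ∧ w.HasPeriod p}

/-- The exponent `exp(w) = |w| / p(w)` of a finite (nonempty) word. -/
noncomputable def wordExp (w : List α) : ℝ :=
  (w.length : ℝ) / (leastPeriod w : ℝ)

/-- The set of exponents of the nonempty factors (contiguous blocks) of the conjugates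
(cyclic shifts) of `w`. -/
def circExponents (w : List α) : Set ℝ :=
  {r : ℝ | ∃ v x : List α, w ~r v ∧ x <:+: v ∧ x ≠ [] ∧ r = wordExp x}

/-- The circular critical exponent of `w`: the supremum of the exponents of all nonempty factors
of all conjugates of `w`. -/
noncomputable def ccexp (w : List α) : ℝ :=
  sSup (circExponents w)

theorem leastPeriod_spec {w : List α} (hw : w ≠ []) :
    1 ≤ leastPeriod w ∧ w.HasPeriod (leastPeriod w) :=
  Nat.sInf_mem (s := {p : ℕ | 1 ≤ p ∧ w.HasPeriod p})
    ⟨w.length, List.length_pos_iff.mpr hw, List.hasPeriod_of_length_le w _ le_rfl⟩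

/-- For a nonempty word the supremum defining `ccexp` is a genuine one. -/
theorem isLUB_ccexp {w : List α} (hw : w ≠ []) : IsLUB (circExponents w) (ccexp w) := by
  apply isLUB_csSup
  · exact ⟨_, w, w, List.IsRotated.refl w, List.infix_refl w, hw, rfl⟩
  · refine ⟨(w.length : ℝ), ?_⟩
    rintro r ⟨v, x, hv, hx, hne, rfl⟩
    have h1 : (1 : ℝ) ≤ (leastPeriod x : ℝ) := by exact_mod_cast (leastPeriod_spec hne).1
    have h2 : (x.length : ℝ) ≤ (w.length : ℝ) := by
      have := hx.length_le
      rw [← hv.perm.length_eq] at this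
      exact_mod_cast this
    exact (div_le_self (Nat.cast_nonneg _) h1).trans h2

end CircWord

/-! ### The Thue–Morse word -/

namespace ThueMorse

/-- The morphism `μ` on letters: `0 ↦ 01`, `1 ↦ 10`. -/
def mu : Fin 2 → List (Fin 2)
  | 0 => [0, 1]
  | 1 => [1, 0]

/-- The morphism `μ` on finite words. -/
def muWord (w : List (Fin 2)) : List (Fin 2) := w.flatMap mu

/-- The Thue–Morse word `t = μ^ω(0)`, indexed from `0`. Each `μ^k(0)` is a prefix of
`μ^(k+1)(0)` and has length `2^k`, so `t_n` is the letter at position `n` of `μ^n(0)`. -/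
def t (n : ℕ) : Fin 2 := (muWord^[n] [0]).getD n 0

/-- The prefix of length `n` of the Thue–Morse word. -/
def tmPrefix (n : ℕ) : List (Fin 2) := (List.range n).map t

theorem mu_length (a : Fin 2) : (mu a).length = 2 := by
  fin_cases a <;> rfl

theorem muWord_append (u v : List (Fin 2)) : muWord (u ++ v) = muWord u ++ muWord v := by
  simp [muWord]

theorem muWord_length (w : List (Fin 2)) : (muWord w).length = 2 * w.length := by
  induction w with
  | nil => rfl
  | cons a w ih =>
    have : muWord (a :: w) = mu a ++ muWord w := by simp [muWord]
    rw [this, List.length_append, ih, mu_length, List.length_cons]; ring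

theorem iter_length (k : ℕ) : (muWord^[k] [0]).length = 2 ^ k := by
  induction k with
  | zero => rfl
  | succ k ih => rw [Function.iterate_succ_apply', muWord_length, ih]; ring

theorem iter_prefix_succ (k : ℕ) : muWord^[k] [0] <+: muWord^[k + 1] [0] := by
  induction k with
  | zero => exact ⟨[1], rfl⟩
  | succ k ih =>
    obtain ⟨s, hs⟩ := ih
    refine ⟨muWord s, ?_⟩
    rw [Function.iterate_succ_apply', Function.iterate_succ_apply' _ (k + 1), ← hs, muWord_append]

theorem iter_prefix {k l : ℕ} (h : k ≤ l) : muWord^[k] [0] <+: muWord^[l] [0] := by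
  induction l, h using Nat.le_induction with
  | base => exact List.prefix_refl _
  | succ l _ ih => exact ih.trans (iter_prefix_succ l)

theorem iter_getElem? {k n : ℕ} (h : n < 2 ^ k) : (muWord^[k] [0])[n]? = some (t n) := by
  have hn : n < (muWord^[n] [0]).length := by rw [iter_length]; exact Nat.lt_two_pow_self
  have hk : n < (muWord^[k] [0]).length := by rw [iter_length]; exact h
  have ht : t n = (muWord^[n] [0])[n] :=
    List.getD_eq_getElem _ _ hn
  rw [ht, List.getElem?_eq_getElem hk]
  rcases le_total k n with hkn | hkn
  · rw [(iter_prefix hkn).getElem hk]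
  · rw [(iter_prefix hkn).getElem hn]

theorem tmPrefix_two_pow (k : ℕ) : tmPrefix (2 ^ k) = muWord^[k] [0] := by
  apply List.ext_getElem?
  intro i
  by_cases hi : i < 2 ^ k
  · rw [iter_getElem? hi]; simp [tmPrefix, hi]
  · rw [List.getElem?_eq_none (by simpa [tmPrefix] using hi),
      List.getElem?_eq_none (by rw [iter_length]; exact not_lt.mp hi)]

theorem tmPrefix_prefix {m n : ℕ} (h : m ≤ n) : tmPrefix m <+: tmPrefix n := by
  obtain ⟨d, rfl⟩ := Nat.exists_eq_add_of_le h
  refine ⟨(List.range d).map (fun i => t (m + i)), ?_⟩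
  simp [tmPrefix, List.range_add, Function.comp_def]

/-- `t` starts with `0`. -/
theorem t_zero : t 0 = 0 := rfl

/-- `t` is fixed by `μ`: the image of each prefix is the prefix of twice the length. -/
theorem muWord_tmPrefix (n : ℕ) : muWord (tmPrefix n) = tmPrefix (2 * n) := by
  have hlt : n ≤ 2 ^ n := Nat.lt_two_pow_self.le
  have h1 : muWord (tmPrefix n) <+: tmPrefix (2 ^ (n + 1)) := by
    obtain ⟨s, hs⟩ := tmPrefix_prefix hlt
    refine ⟨muWord s, ?_⟩
    rw [← muWord_append, hs, tmPrefix_two_pow, tmPrefix_two_pow, Function.iterate_succ_apply']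
  have h2 : tmPrefix (2 * n) <+: tmPrefix (2 ^ (n + 1)) :=
    tmPrefix_prefix (by rw [pow_succ]; omega)
  have hl : (muWord (tmPrefix n)).length = (tmPrefix (2 * n)).length := by
    rw [muWord_length]; simp [tmPrefix]
  exact (List.prefix_of_prefix_length_le h1 h2 hl.le).eq_of_length hl

end ThueMorse

/-! ### The automaton with output that describes the prefixes -/

/-- A deterministic finite automaton with output (its state set is made finite by the choice of
`σ`), reading letters from `α` and producing an element of `Δ`. -/
structure DFAO (α σ Δ : Type*) where
  /-- The transition function. -/
  step : σ → α → σ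
  /-- The initial state. -/
  start : σ
  /-- The output mapping. -/
  out : σ → Δ

/-- The output of a `2`-DFAO on input `n`, whose base-`2` representation is read from the most
significant digit to the least significant one (`Nat.bits` lists the least significant first). -/
def DFAO.output {σ Δ : Type*} (M : DFAO Bool σ Δ) (n : ℕ) : Δ :=
  M.out (n.bits.reverse.foldl M.step M.start)

namespace ThueMorse

/-- Transitions on the digit `0`. -/
def next0 : Fin 29 → Fin 29 :=
  ![0, 2, 4, 6, 8, 10, 11, 13, 4, 16, 5, 18, 19, 20, 21, 22, 23, 24, 11, 12, 25, 26, 15, 27, 17,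
    20, 28, 23, 26]

/-- Transitions on the digit `1`. -/
def next1 : Fin 29 → Fin 29 :=
  ![1, 3, 5, 7, 9, 7, 12, 14, 15, 7, 17, 7, 9, 5, 7, 7, 12, 9, 17, 15, 9, 12, 17, 7, 15, 15, 7,
    17, 17]

/-- Outputs of the states. The output of state `0`, reached only by `n = 0`, is immaterial. -/
def stateOut : Fin 29 → ℚ :=
  ![0, 1, 1, 2, 2, 5/2, 2, 3, 2, 8/3, 5/2, 2, 7/3, 3, 3, 13/5, 8/3, 8/3, 2, 7/3, 3, 3, 13/5, 8/3,
    8/3, 3, 3, 8/3, 3]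

/-- The explicit `29`-state `2`-DFAO for the circular critical exponents of the prefixes. -/
def prefixDFAO : DFAO Bool (Fin 29) ℚ where
  step q b := if b then next1 q else next0 q
  start := 0
  out := stateOut

end ThueMorse

/-!
Write `n`-circular word for the circular word spelled by the prefix of length `n`. Three facts
determine its critical exponent.

* Doubling (`HasCritExp.two_mul`). The `2n`-circular word is the image of the `n`-circular word under
  the morphism. A repetition of odd period in such an image has exponent at most `2`, since
  otherwise its letters alternate; a repetition of even period and exponent above `2` comes from a
  repetition of the same or larger exponent in the `n`-circular word. So the critical exponents of
  the lengths `n` and `2n` agree as soon as the former is at least `2`, and the automaton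
  has the same output on `n` and `2n` for `n ≥ 3`.
* Locality at the seam (`seamSides_of_isRep`). As the Thue–Morse word is overlap-free, a repetition of
  exponent above `2` has to cross the seam, where the end of the prefix meets its beginning.
  If `n` is odd, the block structures on the two sides of the seam have opposite parity, while no
  factor of length `5` occurs at positions of both parities (`no_common_five_of_odd`). If the
  exponent is above `7/3`, this bounds the period by `23` and the repetition by `31` letters on
  each side of the seam.
* Finitely many seams. For odd `n = 32k + r` with `k ≥ 1` and `r < 32`, the letters near the seam are
  determined by `r`, `t (k - 1)` and `t k`, and the state reached by `k` determines the
  two letters (`readState_letters`). So the odd lengths reduce to `64` seams (`seam_check`), and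
  the lengths below `32` are treated one by one (`short_check`).
-/

namespace ThueMorse

/-! ### Blocks and overlap-freeness of the Thue–Morse word -/

theorem t_two_mul_add (k : ℕ) (b : Fin 2) : t (2 * k + b) = t k + b := by
  have h := muWord_tmPrefix (k + 1)
  have hp : tmPrefix (k + 1) = tmPrefix k ++ [t k] := by simp [tmPrefix, List.range_succ]
  have hp2 : tmPrefix (2 * (k + 1)) = tmPrefix (2 * k) ++ [t (2 * k), t (2 * k + 1)] := by
    simp [tmPrefix, Nat.mul_add, List.range_succ]
  rw [hp, muWord_append, muWord_tmPrefix, hp2, List.append_cancel_left_eq] at h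
  generalize t k = x, hy : t (2 * k) = y, hz : t (2 * k + 1) = z at h
  have key : ∀ x y z : Fin 2, muWord [x] = [y, z] → y = x ∧ z = x + 1 := by decide
  obtain ⟨rfl, rfl⟩ := key x y z h
  fin_cases b
  · simpa using hy
  · simpa using hz

theorem t_two_mul (k : ℕ) : t (2 * k) = t k := by simpa using t_two_mul_add k 0

theorem t_two_mul_add_one (k : ℕ) : t (2 * k + 1) = t k + 1 := by simpa using t_two_mul_add k 1

theorem t_two_pow_mul_add (j k x : ℕ) (hx : x < 2 ^ j) : t (2 ^ j * k + x) = t k + t x := by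
  induction j generalizing x with
  | zero =>
    obtain rfl : x = 0 := by omega
    simp [t_zero]
  | succ j ih =>
    have h2 : 2 ^ (j + 1) * k = 2 * (2 ^ j * k) := by ring
    rcases Nat.even_or_odd' x with ⟨y, rfl | rfl⟩
    · rw [h2, ← Nat.mul_add, t_two_mul, t_two_mul, ih y (by omega)]
    · rw [h2, ← add_assoc, ← Nat.mul_add, t_two_mul_add_one, t_two_mul_add_one, ih y (by omega),
        add_assoc]

theorem t_ne_t_add_one {y : ℕ} (hy : Even y) : t y ≠ t (y + 1) := by
  obtain ⟨k, rfl⟩ := hy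
  rw [← two_mul, t_two_mul, t_two_mul_add_one]
  generalize t k = a
  revert a; decide

theorem not_eq_eq_step_one (y : ℕ) : ¬(t y = t (y + 1) ∧ t (y + 1) = t (y + 2)) := by
  rintro ⟨h1, h2⟩
  rcases Nat.even_or_odd y with h | h
  · exact t_ne_t_add_one h h1
  · exact t_ne_t_add_one h.add_one h2

theorem not_eq_eq_step_two (y : ℕ) : ¬(t y = t (y + 2) ∧ t (y + 2) = t (y + 4)) := by
  rintro ⟨h1, h2⟩
  apply not_eq_eq_step_one (y / 2)
  rcases Nat.even_or_odd' y with ⟨k, rfl | rfl⟩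
  · rw [show 2 * k + 2 = 2 * (k + 1) by ring, show 2 * k + 4 = 2 * (k + 2) by ring] at *
    simp only [t_two_mul] at h1 h2
    rw [show 2 * k / 2 = k by omega]
    exact ⟨h1, h2⟩
  · rw [show 2 * k + 1 + 2 = 2 * (k + 1) + 1 by ring,
      show 2 * k + 1 + 4 = 2 * (k + 2) + 1 by ring] at *
    simp only [t_two_mul_add_one, add_left_inj] at h1 h2
    rw [show (2 * k + 1) / 2 = k by omega]
    exact ⟨h1, h2⟩

theorem eq_of_ne_of_ne {a b c : Fin 2} (hab : a ≠ b) (hbc : b ≠ c) : a = c := by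
  omega

/-- If a factor occurs at positions of different parity, then its letters alternate, because every
pair of adjacent letters is a block `01` or `10` in one of the two occurrences. -/
theorem ne_succ_of_occurrences {y z l : ℕ} (hyz : Odd (y + z))
    (h : ∀ j < l, t (y + j) = t (z + j)) {j : ℕ} (hj : j + 1 < l) :
    t (y + j) ≠ t (y + j + 1) := by
  rcases Nat.even_or_odd (y + j) with he | ho
  · exact t_ne_t_add_one he
  · have hz : Even (z + j) := by grind
    have := t_ne_t_add_one hz
    rwa [← h j (by omega), add_assoc, ← h (j + 1) hj, ← add_assoc] at this

/-- No factor of length `5` occurs at positions of different parity: it would be `01010` or `10101`,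
which is not a factor of the Thue–Morse word. -/
theorem no_common_five_of_odd {y z : ℕ} (hyz : Odd (y + z)) :
    ¬∀ j < 5, t (y + j) = t (z + j) := by
  intro h
  have a0 := ne_succ_of_occurrences hyz h (j := 0) (by omega)
  have a1 := ne_succ_of_occurrences hyz h (j := 1) (by omega)
  have a2 := ne_succ_of_occurrences hyz h (j := 2) (by omega)
  have a3 := ne_succ_of_occurrences hyz h (j := 3) (by omega)
  exact not_eq_eq_step_two y ⟨eq_of_ne_of_ne a0 a1, eq_of_ne_of_ne a2 a3⟩

/-- The Thue–Morse word is overlap-free: no factor of length `2 * p + 1` has period `p`. For even `p`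
the overlap is the image under the morphism of one with period `p / 2`, up to its ends; for odd `p`
it contains a factor that occurs at positions of different parity. -/
theorem overlap_free {p : ℕ} (hp : 1 ≤ p) (y : ℕ) : ¬∀ j ≤ p, t (y + j) = t (y + j + p) := by
  induction p using Nat.strong_induction_on generalizing y with
  | _ p ih =>
    intro h
    have h' : ∀ j < p + 1, t (y + j) = t (y + p + j) := fun j hj => by
      rw [h j (by omega)]; congr 1; omega
    rcases Nat.even_or_odd' p with ⟨q, rfl | hq⟩
    · refine ih q (by omega) (by omega) (y / 2) fun j hj => ?_
      rcases Nat.even_or_odd' y with ⟨k, rfl | rfl⟩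
      · have := h (2 * j) (by omega)
        rw [← Nat.mul_add, ← Nat.mul_add, t_two_mul, t_two_mul] at this
        rwa [show 2 * k / 2 = k by omega]
      · have := h (2 * j) (by omega)
        rw [show 2 * k + 1 + 2 * j = 2 * (k + j) + 1 by ring,
          show 2 * (k + j) + 1 + 2 * q = 2 * (k + j + q) + 1 by ring, t_two_mul_add_one,
          t_two_mul_add_one, add_left_inj] at this
        rwa [show (2 * k + 1) / 2 = k by omega]
    · have hodd : Odd (y + (y + p)) := by grind
      rcases Nat.lt_or_ge p 5 with hlt | hge
      · have a0 := h 0 (by omega)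
        have a1 := h 1 (by omega)
        obtain rfl | rfl : p = 1 ∨ p = 3 := by omega
        · exact not_eq_eq_step_one y ⟨a0, a1⟩
        · have b0 := ne_succ_of_occurrences hodd h' (j := 0) (by omega)
          have b1 := ne_succ_of_occurrences hodd h' (j := 1) (by omega)
          have b2 := ne_succ_of_occurrences hodd h' (j := 2) (by omega)
          have e := eq_of_ne_of_ne b0 b1
          simp only [add_zero, add_assoc, Nat.reduceAdd] at *
          exact b2 (e.symm.trans a0)
      · exact no_common_five_of_odd hodd fun j hj => h' j (by omega)

/-! ### Repetitions in circular prefixes -/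

/-- The letter at position `x` of the periodic word obtained by repeating the prefix of length
`n` of the Thue–Morse word. Its blocks of length at most `n` are exactly the
factors of the conjugates of that prefix. -/
def circ (n x : ℕ) : Fin 2 := t (x % n)

/-- The block of length `l` at position `i` of the circular word `circ n` has period `p`. -/
def IsRep (n i l p : ℕ) : Prop := ∀ j, j + p < l → circ n (i + j) = circ n (i + j + p)

/-- The circular critical exponent of the prefix of length `n` is `c / 30`: the blocks of length at
most `n` satisfy this bound, and one of them attains it. The number `30` is a common denominator
of all values that occur, so that the bookkeeping stays in `ℕ`. -/
structure HasCritExp (n c : ℕ) : Prop where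
  le : ∀ i l p, 1 ≤ p → l ≤ n → IsRep n i l p → 30 * l ≤ c * p
  attained : ∃ i l p, 1 ≤ p ∧ 1 ≤ l ∧ l ≤ n ∧ IsRep n i l p ∧ 30 * l = c * p

theorem IsRep.mono {n i l l' p : ℕ} (h : IsRep n i l p) (hl : l' ≤ l) : IsRep n i l' p :=
  fun j hj => h j (by omega)

theorem circ_of_lt {n x : ℕ} (h : x < n) : circ n x = t x := by rw [circ, Nat.mod_eq_of_lt h]

theorem circ_add_self (n x : ℕ) : circ n (n + x) = circ n x := by simp [circ]

theorem IsRep.mod {n i l p : ℕ} (h : IsRep n i l p) : IsRep n (i % n) l p := by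
  intro j hj
  have := h j hj
  simp only [circ, add_assoc] at this ⊢
  rwa [Nat.mod_add_mod, Nat.mod_add_mod]

theorem length_tmPrefix (n : ℕ) : (tmPrefix n).length = n := by simp [tmPrefix]

theorem getElem?_rotate_tmPrefix {n k x : ℕ} (h : x < n) :
    ((tmPrefix n).rotate k)[x]? = some (circ n (k + x)) := by
  have hlt : (x + k) % n < n := Nat.mod_lt _ (by omega)
  rw [List.getElem?_rotate (by rwa [length_tmPrefix]), length_tmPrefix, circ, add_comm k]
  simp [tmPrefix, hlt]

theorem hasPeriod_iff_isRep {n i p : ℕ} {x : List (Fin 2)}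
    (hx : ∀ j < x.length, x[j]? = some (circ n (i + j))) :
    x.HasPeriod p ↔ IsRep n i x.length p := by
  rw [List.hasPeriod_iff_getElem?]
  refine forall_congr' fun j => ?_
  rw [Nat.lt_sub_iff_add_lt]
  refine forall_congr' fun hj => ?_
  rw [hx j (by omega), hx (j + p) hj, Option.some_inj, add_assoc]

theorem ccexp_eq_of_hasCritExp {n c : ℕ} (h : HasCritExp n c) :
    CircWord.ccexp (tmPrefix n) = (c : ℝ) / 30 := by
  obtain ⟨i, l, p, hp, hl, hln, hrep, heq⟩ := h.attained
  have hne : tmPrefix n ≠ [] := by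
    rw [← List.length_pos_iff, length_tmPrefix]; omega
  have hlub := CircWord.isLUB_ccexp hne
  apply le_antisymm
  · apply hlub.2
    rintro _ ⟨v, x, ⟨k, rfl⟩, hxv, hx, rfl⟩
    obtain ⟨m, hm, hget⟩ := List.infix_iff_getElem?.mp hxv
    rw [List.length_rotate, length_tmPrefix] at hm
    have hx' : ∀ j < x.length, x[j]? = some (circ n (k + m + j)) := fun j hj => by
      rw [List.getElem?_eq_getElem hj, ← hget j hj, getElem?_rotate_tmPrefix (by omega)]
      congr 2; omega
    obtain ⟨h1, h2⟩ := CircWord.leastPeriod_spec hx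
    have hb := h.le _ _ _ h1 (by omega) ((hasPeriod_iff_isRep hx').mp h2)
    rw [CircWord.wordExp, div_le_div_iff₀ (by exact_mod_cast h1) (by norm_num)]
    exact_mod_cast (mul_comm _ _).trans_le hb
  · let x := ((tmPrefix n).rotate i).take l
    have hxl : x.length = l := by
      simp only [x, List.length_take, List.length_rotate, length_tmPrefix]; omega
    have hx : x ≠ [] := by rw [← List.length_pos_iff]; omega
    have hx' : ∀ j < x.length, x[j]? = some (circ n (i + j)) := fun j hj => by
      rw [List.getElem?_take_of_lt (by omega), getElem?_rotate_tmPrefix (by omega)]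
    have hper : CircWord.leastPeriod x ≤ p :=
      Nat.sInf_le ⟨hp, (hasPeriod_iff_isRep hx').mpr (by rwa [hxl])⟩
    have hpos := (CircWord.leastPeriod_spec hx).1
    refine le_trans ?_ (hlub.1 ⟨_, x, ⟨i, rfl⟩, (List.take_prefix _ _).isInfix, hx, rfl⟩)
    rw [CircWord.wordExp, hxl, div_le_div_iff₀ (by norm_num) (by exact_mod_cast hpos)]
    have : c * CircWord.leastPeriod x ≤ l * 30 := by nlinarith
    exact_mod_cast this

/-! ### Doubling the length -/

theorem circ_two_mul_add (n x : ℕ) (b : Fin 2) :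
    circ (2 * n) (2 * x + b) = circ n x + b := by
  have : (2 * x + (b : ℕ)) % (2 * n) = 2 * (x % n) + b := by
    rw [Nat.mod_mul, show (2 * x + (b : ℕ)) / 2 = x by omega,
      show (2 * x + (b : ℕ)) % 2 = b by omega, add_comm]
  rw [circ, this, t_two_mul_add, circ]

theorem circ_two_mul (n x : ℕ) : circ (2 * n) (2 * x) = circ n x := by
  simpa using circ_two_mul_add n x 0

theorem circ_two_mul_add_one (n x : ℕ) : circ (2 * n) (2 * x + 1) = circ n x + 1 := by
  simpa using circ_two_mul_add n x 1

theorem circ_two_mul_eq_iff {n x y : ℕ} (h : Even (x + y)) :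
    circ (2 * n) x = circ (2 * n) y ↔ circ n (x / 2) = circ n (y / 2) := by
  rcases Nat.even_or_odd' x with ⟨a, rfl | rfl⟩ <;> rcases Nat.even_or_odd' y with ⟨b, rfl | rfl⟩
  · simp [circ_two_mul]
  · grind
  · grind
  · simp only [circ_two_mul_add_one, add_left_inj]
    rw [show (2 * a + 1) / 2 = a by omega, show (2 * b + 1) / 2 = b by omega]

theorem circ_two_mul_ne {n x : ℕ} (h : Even x) : circ (2 * n) x ≠ circ (2 * n) (x + 1) := by
  obtain ⟨k, rfl⟩ := h
  rw [← two_mul, circ_two_mul, circ_two_mul_add_one]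
  generalize circ n k = a
  revert a; decide

/-- In the circular image of a word under the morphism, a repetition of odd period has exponent at
most `2`: otherwise all its letters would alternate, so that letters at an odd distance differ. -/
theorem le_two_mul_of_isRep_of_odd {n i l p : ℕ} (hp : Odd p) (h : IsRep (2 * n) i l p) :
    l ≤ 2 * p := by
  by_contra! hl
  have hpos := hp.pos
  -- Consecutive letters differ: a pair that is not a block becomes one after a shift by `p`.
  have hne : ∀ j ≤ p, circ (2 * n) (i + j) ≠ circ (2 * n) (i + j + 1) := by
    intro j hj
    rcases Nat.even_or_odd (i + j) with he | ho
    · exact circ_two_mul_ne he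
    · rcases Nat.lt_or_ge (j + 1 + p) l with hlt | hge
      · have e0 := h j (by omega)
        have e1 := h (j + 1) hlt
        rw [e0, add_assoc i j 1, e1]
        have := circ_two_mul_ne (n := n) (x := i + j + p) (by grind)
        rwa [show i + (j + 1) + p = i + j + p + 1 by ring]
      · obtain rfl : j = p := by omega
        have e0 := h 0 (by omega)
        have e1 := h 1 (by omega)
        rw [add_zero] at e0
        rw [← e0, add_right_comm, ← e1]
        exact circ_two_mul_ne (by grind)
  have alt : ∀ m, 2 * m ≤ p → circ (2 * n) (i + 2 * m) = circ (2 * n) i := by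
    intro m hm
    induction m with
    | zero => rfl
    | succ m ih =>
      have h0 := hne (2 * m) (by omega)
      have h1 := hne (2 * m + 1) (by omega)
      exact (eq_of_ne_of_ne h0 h1).symm.trans (ih (by omega))
  obtain ⟨q, rfl⟩ := hp
  exact hne (2 * q) (by omega) ((alt q (by omega)).trans (h 0 (by omega)))

/-- The morphism preserves circular critical exponents that are at least `2`: repetitions of even
period and exponent greater than `2` desubstitute, and doubling a repetition keeps its exponent. -/
theorem HasCritExp.two_mul {n c : ℕ} (h : HasCritExp n c) (hc : 60 ≤ c) :
    HasCritExp (2 * n) c where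
  le i l p hp hl hrep := by
    rcases Nat.lt_or_ge (2 * p) l with hgt | hle
    swap
    · nlinarith
    rcases Nat.even_or_odd' p with ⟨q, rfl | hq⟩
    · have hr : IsRep n (i / 2) ((l + 1) / 2) q := by
        intro j hj
        have key : ∀ x, i ≤ x → x + 2 * q < i + l → circ n (x / 2) = circ n (x / 2 + q) := by
          intro x hx1 hx2
          have := hrep (x - i) (by omega)
          rw [show i + (x - i) = x by omega, circ_two_mul_eq_iff (by grind)] at this
          rwa [show (x + 2 * q) / 2 = x / 2 + q by omega] at this
        -- The letter with index `i / 2 + j` is recovered from any letter of its block that lies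
        -- inside the repetition.
        have := key (i + 2 * j) (by omega) (by omega)
        rwa [show (i + 2 * j) / 2 = i / 2 + j by omega] at this
      have := h.le _ _ q (by omega) (by omega) hr
      nlinarith [Nat.div_add_mod (l + 1) 2, Nat.mod_lt (l + 1) two_pos]
    · have := le_two_mul_of_isRep_of_odd (by grind) hrep
      omega
  attained := by
    obtain ⟨i, l, p, hp, hl, hln, hrep, heq⟩ := h.attained
    refine ⟨2 * i, 2 * l, 2 * p, by omega, by omega, by omega, fun j hj => ?_, by linarith⟩
    rw [circ_two_mul_eq_iff (by grind)]
    have := hrep (j / 2) (by omega)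
    rwa [show (2 * i + j) / 2 = i + j / 2 by omega,
      show (2 * i + j + 2 * p) / 2 = i + j / 2 + p by omega]

/-! ### The automaton -/

/-- The state reached by the automaton after reading `n`. -/
def readState (n : ℕ) : Fin 29 := n.bits.reverse.foldl prefixDFAO.step prefixDFAO.start

/-- One step of the automaton, on the last binary digit of `d`. -/
def readDigit (q : Fin 29) (d : ℕ) : Fin 29 := if d % 2 = 1 then next1 q else next0 q

/-- Five steps of the automaton, on the last five binary digits of `d`. -/
def readFive (q : Fin 29) (d : ℕ) : Fin 29 :=
  readDigit (readDigit (readDigit (readDigit (readDigit q (d / 16)) (d / 8)) (d / 4)) (d / 2)) d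

theorem readState_zero : readState 0 = 0 := by simp [readState, prefixDFAO]

theorem readState_eq_readDigit (n : ℕ) : readState n = readDigit (readState (n / 2)) n := by
  rcases Nat.even_or_odd' n with ⟨k, rfl | rfl⟩
  · rw [show 2 * k / 2 = k by omega, readDigit, if_neg (by omega)]
    rcases Nat.eq_zero_or_pos k with rfl | hk
    · rw [mul_zero, readState_zero]; rfl
    · simp [readState, Nat.bit0_bits k hk.ne', List.foldl_append, prefixDFAO]
  · rw [show (2 * k + 1) / 2 = k by omega, readDigit, if_pos (by omega)]
    simp [readState, List.foldl_append, prefixDFAO]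

theorem readState_eq_readFive (n : ℕ) : readState n = readFive (readState (n / 32)) n := by
  rw [readFive, readState_eq_readDigit n, readState_eq_readDigit (n / 2),
    readState_eq_readDigit (n / 2 / 2), readState_eq_readDigit (n / 2 / 2 / 2),
    readState_eq_readDigit (n / 2 / 2 / 2 / 2)]
  simp only [Nat.div_div_eq_div_mul, Nat.reduceMul]

theorem readFive_mod (q : Fin 29) (n : ℕ) : readFive q n = readFive q (n % 32) := by
  have h : ∀ m, (n % 32) / 2 ^ m % 2 = n / 2 ^ m % 2 ∨ 5 ≤ m := by
    intro m
    rcases Nat.lt_or_ge m 5 with h | h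
    · left; interval_cases m <;> omega
    · exact Or.inr h
  have h0 := (h 0).resolve_right (by omega)
  have h1 := (h 1).resolve_right (by omega)
  have h2 := (h 2).resolve_right (by omega)
  have h3 := (h 3).resolve_right (by omega)
  have h4 := (h 4).resolve_right (by omega)
  norm_num at h0 h1 h2 h3 h4
  simp only [readFive, readDigit, h1, h2, h3, h4, Nat.mod_mod_of_dvd n (show 2 ∣ 32 by norm_num)]

/-- The output of a state, multiplied by `30`. -/
def outCode : Fin 29 → ℕ :=
  ![0, 30, 30, 60, 60, 75, 60, 90, 60, 80, 75, 60, 70, 90, 90, 78, 80, 80, 60, 70, 90, 90, 78, 80,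
    80, 90, 90, 80, 90]

theorem stateOut_eq (q : Fin 29) : stateOut q = (outCode q : ℚ) / 30 := by
  fin_cases q <;> norm_num [stateOut, outCode]

/-- The letter `t (n - 1)`, which is the same for all `n ≥ 1` that lead to a given
state. The value at the state `0`, reached only by `n = 0`, is immaterial. -/
def prevLetter : Fin 29 → Fin 2 :=
  ![0, 0, 1, 1, 0, 1, 0, 0, 1, 1, 0, 1, 0, 1, 1, 1, 0, 0, 0, 1, 0, 0, 0, 1, 1, 1, 1, 0, 0]

/-- The letter `t n`, which is the same for all `n ≥ 1` that lead to a given state.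
The value at the state `0` is immaterial. -/
def curLetter : Fin 29 → Fin 2 :=
  ![0, 1, 1, 0, 1, 0, 0, 1, 1, 0, 0, 0, 1, 1, 0, 0, 0, 1, 0, 1, 1, 0, 0, 0, 1, 1, 0, 0, 0]

theorem letters_next : ∀ q : Fin 29, q ≠ 0 →
    (next0 q ≠ 0 ∧ prevLetter (next0 q) = prevLetter q + 1 ∧ curLetter (next0 q) = curLetter q) ∧
    (next1 q ≠ 0 ∧ prevLetter (next1 q) = curLetter q ∧
      curLetter (next1 q) = curLetter q + 1) := by
  decide +kernel

theorem readState_letters {n : ℕ} (hn : 1 ≤ n) :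
    readState n ≠ 0 ∧ prevLetter (readState n) = t (n - 1) ∧ curLetter (readState n) = t n := by
  induction n using Nat.strong_induction_on with
  | _ n ih =>
    rw [readState_eq_readDigit]
    rcases Nat.even_or_odd' n with ⟨k, rfl | rfl⟩
    · obtain ⟨h0, h1, h2⟩ := ih k (by omega) (by omega)
      obtain ⟨⟨g0, g1, g2⟩, -⟩ := letters_next _ h0
      rw [show 2 * k / 2 = k by omega, readDigit, if_neg (by omega), g1, g2, h1, h2, t_two_mul,
        show 2 * k - 1 = 2 * (k - 1) + 1 by omega, t_two_mul_add_one]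
      exact ⟨g0, rfl, rfl⟩
    · rw [show (2 * k + 1) / 2 = k by omega, readDigit, if_pos (by omega)]
      rcases Nat.eq_zero_or_pos k with rfl | hk
      · rw [readState_zero]; exact ⟨by decide, by decide, by decide⟩
      · obtain ⟨h0, h1, h2⟩ := ih k (by omega) hk
        obtain ⟨-, g0, g1, g2⟩ := letters_next _ h0
        rw [g1, g2, h2, t_two_mul_add_one, Nat.add_sub_cancel, t_two_mul]
        exact ⟨g0, rfl, rfl⟩

theorem next_lower_bounds : ∀ q : Fin 29, (q ≠ 0 → 3 ≤ next1 q) ∧ (2 ≤ q → 3 ≤ next0 q) ∧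
    (q ≠ 0 → 2 ≤ next0 q) := by
  decide +kernel

theorem three_le_readState {n : ℕ} (hn : 3 ≤ n) : 3 ≤ readState n := by
  have pos {m : ℕ} (hm : 1 ≤ m) : readState m ≠ 0 := (readState_letters hm).1
  have two {m : ℕ} (hm : 2 ≤ m) : 2 ≤ readState m := by
    have key := next_lower_bounds (readState (m / 2))
    have h0 := pos (m := m / 2) (by omega)
    rw [readState_eq_readDigit, readDigit]
    split
    · exact le_trans (by decide) (key.1 h0)
    · exact key.2.2 h0
  have key := next_lower_bounds (readState (n / 2))
  rw [readState_eq_readDigit, readDigit]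
  split
  · exact key.1 (pos (by omega))
  · exact key.2.1 (two (by omega))

theorem outCode_of_three_le : ∀ q : Fin 29, 3 ≤ q →
    60 ≤ outCode q ∧ outCode (next0 q) = outCode q := by
  decide +kernel

/-- A state `q` with `prevLetter q = u` and `curLetter q = v`. -/
def letterState (u v : Fin 2) : Fin 29 := ![![6, 4], ![3, 2]] u v

/-- For odd `n = 32 * k + r` the output depends only on `r` and on the letters `t (k - 1)` and `t k`:
these determine the letters in front of the seam. -/
theorem outCode_readFive : ∀ q : Fin 29, q ≠ 0 → ∀ h < 16,
    outCode (readFive q (2 * h + 1)) =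
      outCode (readFive (letterState (prevLetter q) (curLetter q)) (2 * h + 1)) := by
  decide +kernel

/-! ### Letters near the seam of a circular prefix -/

/-- The first `32` letters of the Thue–Morse word, as the binary digits of a number. -/
def prefixLetter (x : ℕ) : Fin 2 := if Nat.testBit 2523490710 x then 1 else 0

theorem t_eq_prefixLetter {x : ℕ} (hx : x < 32) : t x = prefixLetter x := by
  have key : ∀ x < 32, prefixLetter x = prefixLetter (x / 2) + if x % 2 = 1 then 1 else 0 := by
    decide +kernel
  induction x using Nat.strong_induction_on with
  | _ x ih =>
    rcases Nat.eq_zero_or_pos x with rfl | hpos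
    · rfl
    · rw [key x hx, ← ih (x / 2) (by omega) (by omega)]
      rcases Nat.even_or_odd' x with ⟨k, rfl | rfl⟩
      · rw [t_two_mul, if_neg (by omega), add_zero]; congr 1; omega
      · rw [t_two_mul_add_one, if_pos (by omega)]; congr 2; omega

/-- The letters of the circular word of length `32 * k + r` around its seam, starting at position
`32 * (k - 1)`, where `u = t (k - 1)` and `v = t k`. The seam is in front of the letter with
index `32 + r`. -/
def seamLetter (u v : Fin 2) (r x : ℕ) : Fin 2 :=
  if x < 32 then u + prefixLetter x
  else if x < 32 + r then v + prefixLetter (x - 32)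
  else prefixLetter (x - (32 + r))

theorem circ_eq_seamLetter {k r x : ℕ} (hk : 1 ≤ k) (hr : r < 32) (hx : x < 64 + r) :
    circ (32 * k + r) (32 * (k - 1) + x) = seamLetter (t (k - 1)) (t k) r x := by
  have h32 (m : ℕ) {y : ℕ} (hy : y < 32) : t (32 * m + y) = t m + prefixLetter y := by
    rw [← t_eq_prefixLetter hy]; exact t_two_pow_mul_add 5 m y hy
  rw [seamLetter]
  split_ifs with h1 h2
  · rw [circ_of_lt (by omega), h32 _ h1]
  · rw [circ_of_lt (by omega), ← h32 _ (by omega)]; congr 1; omega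
  · rw [← t_eq_prefixLetter (by omega), ← circ_of_lt (n := 32 * k + r) (by omega),
      ← circ_add_self _ (x - (32 + r))]
    congr 1; omega

/-- The block of length `l` that starts `a` letters in front of the seam has period `p`. -/
def IsSeamRep (u v : Fin 2) (r a l p : ℕ) : Prop :=
  ∀ j < l - p, seamLetter u v r (32 + r - a + j) = seamLetter u v r (32 + r - a + j + p)

instance (u v : Fin 2) (r a l p : ℕ) : Decidable (IsSeamRep u v r a l p) :=
  inferInstanceAs (Decidable (∀ j < l - p, _ = _))

/-- The constraints that the parity of blocks puts on a repetition of period `p` with `a` letters in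
front of the seam and `b` letters behind it. -/
def SeamSides (p a b : ℕ) : Prop :=
  b < 32 ∧ if p % 2 = 1 then a ≤ p + 4 ∧ b ≤ p + 4 else p < 5 ∨ a ≤ 4 ∨ b ≤ 4

instance (p a b : ℕ) : Decidable (SeamSides p a b) := by
  unfold SeamSides; infer_instance

/-- No repetition of length `l` and period `p` that satisfies `SeamSides` crosses the seam. -/
def SeamFree (u v : Fin 2) (r l p : ℕ) : Prop :=
  ∀ a < 32, a < l → SeamSides p a (l - a) → ¬IsSeamRep u v r a l p

/-- No repetition of exponent greater than `c / 30` crosses the seam, among the periods `p` and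
lengths `c * p / 30 + 1` that are compatible with `SeamSides`. -/
def SeamBound (u v : Fin 2) (r c : ℕ) : Prop :=
  ∀ p < 24, 1 ≤ p → (p % 2 = 1 ∨ p < 12) ∧ c * p / 30 + 1 ≤ 2 * p + 8 →
    SeamFree u v r (c * p / 30 + 1) p

/-- Some repetition of exponent `c / 30` starts less than `14` letters in front of the seam and has
period at most `5`. -/
def SeamAttained (u v : Fin 2) (r c : ℕ) : Prop :=
  ∃ p < 6, 1 ≤ p ∧ ∃ a < 14, c * p % 30 = 0 ∧ IsSeamRep u v r a (c * p / 30) p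

instance (u v : Fin 2) (r l p : ℕ) : Decidable (SeamFree u v r l p) := by
  unfold SeamFree; infer_instance

instance (u v : Fin 2) (r c : ℕ) : Decidable (SeamBound u v r c) := by
  unfold SeamBound; infer_instance

instance (u v : Fin 2) (r c : ℕ) : Decidable (SeamAttained u v r c) := by
  unfold SeamAttained; infer_instance

theorem seam_check : ∀ u v : Fin 2, ∀ h < 16,
    SeamBound u v (2 * h + 1) (outCode (readFive (letterState u v) (2 * h + 1))) ∧
    SeamAttained u v (2 * h + 1) (outCode (readFive (letterState u v) (2 * h + 1))) := by
  decide +kernel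

/-! ### Short prefixes -/

/-- The letters of `circ n` at positions less than `2 * n`, for `n < 32`. -/
def shortLetter (n x : ℕ) : Fin 2 := if x < n then prefixLetter x else prefixLetter (x - n)

theorem circ_eq_shortLetter {n x : ℕ} (hn : n < 32) (hx : x < 2 * n) :
    circ n x = shortLetter n x := by
  rw [shortLetter]
  split_ifs with h
  · rw [circ_of_lt h, t_eq_prefixLetter (by omega)]
  · rw [← t_eq_prefixLetter (by omega), ← circ_of_lt (n := n) (by omega), ← circ_add_self n (x - n)]
    congr 1; omega

/-- The block of length `l` at position `i` of `shortLetter n` has period `p`. -/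
def IsShortRep (n i l p : ℕ) : Prop :=
  ∀ j < l - p, shortLetter n (i + j) = shortLetter n (i + j + p)

instance (n i l p : ℕ) : Decidable (IsShortRep n i l p) :=
  inferInstanceAs (Decidable (∀ j < l - p, _ = _))

/-- All repetitions in `shortLetter n` of length at most `n` have exponent at most `c / 30`. -/
def ShortBound (n c : ℕ) : Prop :=
  ∀ p < n, 1 ≤ p → c * p / 30 + 1 ≤ n → ∀ i < n, ¬IsShortRep n i (c * p / 30 + 1) p

/-- Some repetition in `shortLetter n` of length at most `n` has exponent `c / 30`. -/
def ShortAttained (n c : ℕ) : Prop :=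
  ∃ p < 16, 1 ≤ p ∧ c * p % 30 = 0 ∧ c * p / 30 ≤ n ∧ ∃ i < n, IsShortRep n i (c * p / 30) p

instance (n c : ℕ) : Decidable (ShortBound n c) := by
  unfold ShortBound; infer_instance

instance (n c : ℕ) : Decidable (ShortAttained n c) := by
  unfold ShortAttained; infer_instance

theorem short_check : ∀ n < 32, 1 ≤ n → 30 ≤ outCode (readFive 0 n) ∧
    ShortBound n (outCode (readFive 0 n)) ∧ ShortAttained n (outCode (readFive 0 n)) := by
  decide +kernel

/-! ### Repetitions across the seam of an odd prefix -/

theorem not_isRep_of_add_le {n i l p : ℕ} (hp : 1 ≤ p) (hl : 2 * p < l) (hi : i + l ≤ n) :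
    ¬IsRep n i l p := by
  intro h
  refine overlap_free hp i fun j hj => ?_
  have := h j (by omega)
  rwa [circ_of_lt (by omega), circ_of_lt (by omega)] at this

theorem IsRep.t_left {n i l p j : ℕ} (h : IsRep n i l p) (hj : j + p < l) (hn : i + j + p < n) :
    t (i + j) = t (i + j + p) := by
  have := h j hj
  rwa [circ_of_lt (by omega), circ_of_lt hn] at this

theorem IsRep.t_right {n i l p j : ℕ} (h : IsRep n i l p) (hi : i ≤ n) (hj : n + j + p < i + l)
    (hl : l ≤ n) (hp : 1 ≤ p) : t j = t (j + p) := by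
  have := h (n - i + j) (by omega)
  rw [show i + (n - i + j) = n + j by omega, add_assoc, circ_add_self, circ_add_self,
    circ_of_lt (by omega), circ_of_lt (by omega)] at this
  exact this

theorem IsRep.t_cross {n i l p j : ℕ} (h : IsRep n i l p) (hj : j + p < l) (h1 : i + j < n)
    (h2 : n ≤ i + j + p) (hl : l ≤ n) : t (i + j) = t (i + j + p - n) := by
  have := h j hj
  rwa [circ_of_lt h1, show i + j + p = n + (i + j + p - n) by omega, circ_add_self,
    circ_of_lt (by omega)] at this

/-- A repetition of exponent above `7 / 3` that crosses the seam of a circular word of odd length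
has bounded period and satisfies `SeamSides`. For odd periods, a side longer than `p + 4`
contains a factor of length `5` and its copy at distance `p`; for even periods, two long sides
yield such a factor on one side with its copy on the other, and the block structures of
the two sides have opposite parity. -/
theorem seamSides_of_isRep {n a b p : ℕ} (hn : Odd n) (hp : 1 ≤ p) (ha : 1 ≤ a) (hb : 1 ≤ b)
    (hl : a + b ≤ n) (hlong : 7 * p < 3 * (a + b)) (h : IsRep n (n - a) (a + b) p) :
    p < 24 ∧ (p % 2 = 1 ∨ p < 12) ∧ a + b ≤ 2 * p + 8 ∧ a < 32 ∧ SeamSides p a b := by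
  rcases Nat.even_or_odd p with he | ho
  · have ha2 : a ≤ 2 * p := by
      by_contra! hlt
      exact overlap_free hp (n - a) fun j hj => h.t_left (by omega) (by omega)
    have hb2 : b ≤ 2 * p := by
      by_contra! hlt
      refine overlap_free hp 0 fun j hj => ?_
      rw [zero_add]
      exact h.t_right (by omega) (by omega) (by omega) hp
    have hside : p < 5 ∨ a ≤ 4 ∨ b ≤ 4 := by
      by_contra! hcon
      -- Five letters in front of the seam reappear behind it, at an even distance in the circular
      -- word, hence at positions of opposite parity in the Thue–Morse word.
      obtain ⟨s, hs1, hs2⟩ : ∃ s, s = a - p ∧ s + 5 ≤ a := ⟨a - p, rfl, by omega⟩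
      refine no_common_five_of_odd (y := n - a + s) (z := n - a + s + p - n) ?_ fun j hj => ?_
      · grind
      · have := h.t_cross (j := s + j) (by omega) (by omega) (by omega) hl
        rw [← add_assoc] at this
        rw [this]; congr 1; omega
    have := Nat.even_iff.mp he
    refine ⟨by omega, by omega, by omega, by omega, by omega, ?_⟩
    rwa [if_neg (by omega)]
  · have ha2 : a ≤ p + 4 := by
      by_contra! hlt
      refine no_common_five_of_odd (y := n - a) (z := n - a + p) (by grind) fun j hj => ?_
      rw [h.t_left (by omega) (by omega)]; congr 1; omega
    have hb2 : b ≤ p + 4 := by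
      by_contra! hlt
      refine no_common_five_of_odd (y := 0) (z := p) (by grind) fun j hj => ?_
      rw [zero_add, h.t_right (by omega) (by omega) (by omega) hp, add_comm]
    have := Nat.odd_iff.mp ho
    refine ⟨by omega, by omega, by omega, by omega, by omega, ?_⟩
    rw [if_pos this]; exact ⟨ha2, hb2⟩

theorem isSeamRep_iff {k r a l p : ℕ} (hk : 1 ≤ k) (hr : r < 32) (ha : a < 32) (hl : l < a + 32) :
    IsSeamRep (t (k - 1)) (t k) r a l p ↔ IsRep (32 * k + r) (32 * k + r - a) l p := by
  have key (j : ℕ) (hj : j < l) :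
      seamLetter (t (k - 1)) (t k) r (32 + r - a + j) =
        circ (32 * k + r) (32 * k + r - a + j) := by
    rw [← circ_eq_seamLetter hk hr (by omega)]; congr 1; omega
  refine forall_congr' fun j => ?_
  rw [Nat.lt_sub_iff_add_lt]
  refine forall_congr' fun hj => ?_
  rw [key j (by omega), add_assoc, key (j + p) hj, add_assoc]

theorem hasCritExp_of_seam {k r c : ℕ} (hk : 1 ≤ k) (hr : r < 32) (ho : Odd r) (hc : 70 ≤ c)
    (hc' : c ≤ 90) (hbound : SeamBound (t (k - 1)) (t k) r c)
    (hatt : SeamAttained (t (k - 1)) (t k) r c) : HasCritExp (32 * k + r) c where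
  le i l p hp hl hrep := by
    by_contra! hlt
    set n := 32 * k + r with hn
    have hi : i % n < n := Nat.mod_lt _ (by omega)
    have hdiv := Nat.div_add_mod (c * p) 30
    have hmod := Nat.mod_lt (c * p) (show 0 < 30 by norm_num)
    have hcp : 70 * p ≤ c * p := Nat.mul_le_mul_right p hc
    set m := c * p / 30
    -- The repetition may be cut down to the least length that is too long.
    have hrep' : IsRep n (i % n) (m + 1) p := hrep.mod.mono (by omega)
    rcases Nat.lt_or_ge n (i % n + (m + 1)) with hcross | hin
    · obtain ⟨a, ha⟩ : ∃ a, a = n - i % n := ⟨_, rfl⟩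
      rw [show i % n = n - a by omega] at hrep'
      obtain ⟨b, hb⟩ : ∃ b, m + 1 = a + b ∧ 1 ≤ b := ⟨m + 1 - a, by omega, by omega⟩
      have hodd : Odd n := by grind
      have h' := hrep'
      rw [hb.1] at h'
      obtain ⟨h1, h2, h3, h4, h5⟩ :=
        seamSides_of_isRep hodd hp (by omega) hb.2 (by omega) (by omega) h'
      have hb32 := h5.1
      exact hbound p h1 hp ⟨h2, by omega⟩ a h4 (by omega) (by rwa [show m + 1 - a = b by omega])
        ((isSeamRep_iff hk hr h4 (by omega)).mpr hrep')
    · exact not_isRep_of_add_le hp (by omega) hin hrep'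
  attained := by
    obtain ⟨p, hp6, hp, a, ha, hmod, hrep⟩ := hatt
    have hcp : 70 * p ≤ c * p := Nat.mul_le_mul_right p hc
    have hcp' : c * p ≤ 90 * 5 := Nat.mul_le_mul hc' (by omega)
    refine ⟨32 * k + r - a, c * p / 30, p, hp, by omega, by omega, ?_, by omega⟩
    exact (isSeamRep_iff hk hr (by omega) (by omega)).mp hrep

/-! ### The critical exponent of every prefix -/

theorem isShortRep_iff {n i l p : ℕ} (hn : n < 32) (hi : i < n) (hl : l ≤ n) :
    IsShortRep n i l p ↔ IsRep n i l p := by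
  refine forall_congr' fun j => ?_
  rw [Nat.lt_sub_iff_add_lt]
  refine forall_congr' fun hj => ?_
  rw [circ_eq_shortLetter hn (by omega), circ_eq_shortLetter hn (by omega)]

theorem hasCritExp_of_short {n c : ℕ} (hn : n < 32) (hn1 : 1 ≤ n) (hc : 30 ≤ c)
    (hbound : ShortBound n c) (hatt : ShortAttained n c) : HasCritExp n c where
  le i l p hp hl hrep := by
    by_contra! hlt
    have hi : i % n < n := Nat.mod_lt _ (by omega)
    have hcp : 30 * p ≤ c * p := Nat.mul_le_mul_right p hc
    exact hbound p (by omega) hp (by omega) (i % n) hi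
      ((isShortRep_iff hn hi (by omega)).mpr (hrep.mod.mono (by omega)))
  attained := by
    obtain ⟨p, -, hp, hmod, hle, i, hi, hrep⟩ := hatt
    have hcp : 30 * p ≤ c * p := Nat.mul_le_mul_right p hc
    exact ⟨i, c * p / 30, p, hp, by omega, hle, (isShortRep_iff hn hi hle).mp hrep, by omega⟩

theorem outCode_letterState_bounds : ∀ u v : Fin 2, ∀ h < 16,
    70 ≤ outCode (readFive (letterState u v) (2 * h + 1)) ∧
      outCode (readFive (letterState u v) (2 * h + 1)) ≤ 90 := by
  decide +kernel

theorem hasCritExp_outCode {n : ℕ} (hn : 1 ≤ n) : HasCritExp n (outCode (readState n)) := by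
  induction n using Nat.strong_induction_on with
  | _ n ih =>
    rcases Nat.lt_or_ge n 32 with hlt | hge
    · rw [readState_eq_readFive, Nat.div_eq_of_lt hlt, readState_zero]
      obtain ⟨h1, h2, h3⟩ := short_check n hlt hn
      exact hasCritExp_of_short hlt hn h1 h2 h3
    · rcases Nat.even_or_odd' n with ⟨m, rfl | hm⟩
      · obtain ⟨h1, h2⟩ := outCode_of_three_le _ (three_le_readState (n := m) (by omega))
        rw [readState_eq_readDigit, show 2 * m / 2 = m by omega, readDigit, if_neg (by omega), h2]
        exact (ih m (by omega) (by omega)).two_mul h1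
      · obtain ⟨h0, hu, hv⟩ := readState_letters (n := n / 32) (by omega)
        obtain ⟨s, hs, hs16⟩ : ∃ s, n % 32 = 2 * s + 1 ∧ s < 16 := ⟨n % 32 / 2, by omega, by omega⟩
        rw [readState_eq_readFive, readFive_mod, hs, outCode_readFive _ h0 s hs16, hu, hv]
        obtain ⟨hb, ha⟩ := seam_check (t (n / 32 - 1)) (t (n / 32)) s hs16
        obtain ⟨hc, hc'⟩ := outCode_letterState_bounds (t (n / 32 - 1)) (t (n / 32)) s hs16
        have := hasCritExp_of_seam (by omega) (by omega) ⟨s, rfl⟩ hc hc' hb ha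
        rwa [show 32 * (n / 32) + (2 * s + 1) = n by omega] at this

end ThueMorse

theorem theorem5 :
    (∀ n : ℕ, 1 ≤ n →
      CircWord.ccexp (ThueMorse.tmPrefix n) ∈
        ({1, 2, 7 / 3, 5 / 2, 13 / 5, 8 / 3, 3} : Set ℝ)) ∧
    (∀ n : ℕ, 1 ≤ n →
      CircWord.ccexp (ThueMorse.tmPrefix n) = ((ThueMorse.prefixDFAO.output n : ℚ) : ℝ)) := by
  have key : ∀ n : ℕ, 1 ≤ n →
      CircWord.ccexp (ThueMorse.tmPrefix n) =
        ((ThueMorse.stateOut (ThueMorse.readState n) : ℚ) : ℝ) := fun n hn => by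
    rw [ThueMorse.ccexp_eq_of_hasCritExp (ThueMorse.hasCritExp_outCode hn), ThueMorse.stateOut_eq]
    push_cast
    rfl
  refine ⟨fun n hn => ?_, key⟩
  rw [key n hn]
  have h0 := (ThueMorse.readState_letters hn).1
  generalize ThueMorse.readState n = q at h0 ⊢
  fin_cases q
  · exact absurd rfl h0
  all_goals norm_num [ThueMorse.stateOut]
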